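/- Let $\Theta$ be a compact metric space, let $r:\Theta\to\Theta$ be a continuous map which is uniquely ergodic (there is exactly one $r$-invariant Borel probability measure on $\Theta$), and let $\mathbb{T}^1=\mathbb{R}/\mathbb{Z}$. Let $f:\Theta\times\mathbb{T}^1\to\Theta\times\mathbb{T}^1$ be a continuous map of the form $f(\theta,\varphi)=(r(\theta),f_\theta(\varphi))$ which is homotopic to the map $(\theta,\varphi)\mapsto(r(\theta),\varphi)$. Let $F:\Theta\times\mathbb{R}\to\Theta\times\mathbb{R}$ be a continuous lift of $f$, that is, $\pi\circ F=f\circ\pi$ for the natural projection $\pi:\Theta\times\mathbb{R}\to\Theta\times\mathbb{T}^1$; write $F^n(\theta,x)=(r^n(\theta),F^n_\theta(x))$ for its iterates. If the fibred rotation interval $$\rho_{\mathrm{fib}}(F)=\Big\{\limsup_{n\to\infty}\tfrac1n\big(F^n_\theta(x)-x\big)\ \Big|\ (\theta,x)\in\Theta\times\mathbb{R}\Big\}\subseteq\mathbb{R}$$ has non-empty interior, then the topological entropy of $f$ is strictly positive: $h_{\mathrm{top}}(f)>0$. -/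

import Mathlib

open Filter Topology MeasureTheory

/-- A continuous self-map `r` of a compact metric space is uniquely ergodic if there is exactly one
`r`-invariant Borel probability measure. -/
def IsUniquelyErgodic {Θ : Type*} [MeasurableSpace Θ] (r : Θ → Θ) : Prop :=
  ∃! μ : Measure Θ, IsProbabilityMeasure μ ∧ MeasurePreserving r μ μ

/-- `f` is a skew product over the base map `r`, i.e. `f (θ, φ) = (r θ, f_θ φ)`. As `f` is
continuous, this is an `r`-forced circle endomorphism. -/
def IsForcedCircleMap {Θ : Type*} [TopologicalSpace Θ] (r : C(Θ, Θ))
    (f : C(Θ × UnitAddCircle, Θ × UnitAddCircle)) : Prop :=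
  ∀ (θ : Θ) (φ : UnitAddCircle), (f (θ, φ)).1 = r θ

/-- `f` is "homotopic to the identity": it is homotopic, as a continuous self-map of
`Θ × ℝ/ℤ`, to the map `(θ, φ) ↦ (r θ, φ)`. -/
def IsHomotopicToIdentity {Θ : Type*} [TopologicalSpace Θ] (r : C(Θ, Θ))
    (f : C(Θ × UnitAddCircle, Θ × UnitAddCircle)) : Prop :=
  ContinuousMap.Homotopic f (r.prodMap (ContinuousMap.id UnitAddCircle))

/-- The natural projection `Θ × ℝ → Θ × ℝ/ℤ`. -/
def circleProj {Θ : Type*} (p : Θ × ℝ) : Θ × UnitAddCircle :=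
  (p.1, (p.2 : UnitAddCircle))

/-- The continuous map `F : Θ × ℝ → Θ × ℝ` is a lift of `f`: `π ∘ F = f ∘ π`. -/
def IsCircleLift {Θ : Type*} [TopologicalSpace Θ] (F : C(Θ × ℝ, Θ × ℝ))
    (f : C(Θ × UnitAddCircle, Θ × UnitAddCircle)) : Prop :=
  ∀ p : Θ × ℝ, circleProj (F p) = f (circleProj p)

/-- The fibred rotation interval of a lift `F`: all numbers
`limsup_{n → ∞} (F_θ^n x - x) / n` with `(θ, x) ∈ Θ × ℝ`. Here `F_θ^n x` is the second
coordinate of `F^n (θ, x)`. -/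
noncomputable def fibredRotationInterval {Θ : Type*} (F : Θ × ℝ → Θ × ℝ) : Set ℝ :=
  Set.range fun p : Θ × ℝ =>
    limsup (fun n : ℕ => (1 / (n : ℝ)) * ((F^[n] p).2 - p.2)) atTop

/-- Topological entropy (Bowen's definition by covers with dynamical balls, on the whole space). -/
noncomputable def topEntropy {X : Type*} [UniformSpace X] (f : X → X) : EReal :=
  Dynamics.coverEntropy f Set.univ

/-! Take `a < b` in the rotation interval and `N` with `N (b - a) > 6`. For `G = F^N`, let `D θ` be
the largest minus the smallest displacement of `G` in the fibre of `θ`. Unique ergodicity gives the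
continuous extremal displacements orbit-independent means, at least `N b` and at most `N a`, so `D`
has mean above 6. As `D` is bounded, along suitable `r^N`-orbits a positive proportion of fibres
have `D ≥ 5`. By the intermediate value theorem `G` stretches a fundamental domain of such a fibre
over four; two image pieces at distance 2 have preimages uniformly apart on the circle, and the
number of separated points doubles (`exists_finset_separated`). The other fibres lose nothing
because `G` has degree one. The count is exponential in time, so entropy is positive. -/

/-! ### Birkhoff averages under unique ergodicity -/

/-- Under a uniquely ergodic continuous map the Birkhoff averages of a continuous function converge
at every point, to a limit which does not depend on the point. -/
theorem IsUniquelyErgodic.exists_tendsto_birkhoffAverage {Θ : Type*} [MetricSpace Θ]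
    [CompactSpace Θ] [MeasurableSpace Θ] [BorelSpace Θ] {r : C(Θ, Θ)} (hr : IsUniquelyErgodic r)
    (g : C(Θ, ℝ)) :
    ∃ c : ℝ, ∀ θ : Θ, Tendsto (fun n => birkhoffAverage ℝ r g n θ) atTop (𝓝 c) := by
  obtain ⟨μ, ⟨hμ, hinv⟩, huniq⟩ := hr
  refine ⟨∫ x, g x ∂μ, fun θ => ?_⟩
  -- The shift excludes the empty average. Empirical measures of the orbit converge along any
  -- ultrafilter by weak compactness; the limit is invariant, hence equals `μ`.
  rw [← tendsto_add_atTop_iff_nat 1, tendsto_iff_ultrafilter]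
  intro U hU
  let m : ℕ → Measure Θ := fun n =>
    ((n + 1 : ℕ) : ENNReal)⁻¹ • ∑ k ∈ Finset.range (n + 1), Measure.dirac (r^[k] θ)
  have hm : ∀ n, IsProbabilityMeasure (m n) := fun n => by
    constructor
    simp only [m, Measure.smul_apply, Measure.finsetSum_apply, measure_univ, Finset.sum_const,
      Finset.card_range, smul_eq_mul, nsmul_eq_mul, mul_one]
    exact ENNReal.inv_mul_cancel (by simp) (ENNReal.natCast_ne_top _)
  have hint : ∀ (h : Θ → ℝ), Continuous h → ∀ n,
      ∫ x, h x ∂(m n) = birkhoffAverage ℝ r h (n + 1) θ := fun h hh n => by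
    have : ∀ k ∈ Finset.range (n + 1), Integrable h (Measure.dirac (r^[k] θ)) := fun k _ =>
      hh.integrable_of_hasCompactSupport (HasCompactSupport.of_compactSpace h)
    simp only [m]
    rw [integral_smul_measure, integral_finsetSum_measure this]
    simp only [birkhoffAverage, birkhoffSum, integral_dirac, ENNReal.toReal_inv,
      ENNReal.toReal_natCast]
  let P : ℕ → ProbabilityMeasure Θ := fun n => ⟨m n, hm n⟩
  obtain ⟨ν, -, hν⟩ := isCompact_univ.ultrafilter_le_nhds (U.map P) (by simp)
  have hlim : ∀ h : C(Θ, ℝ),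
      Tendsto (fun n => birkhoffAverage ℝ r h (n + 1) θ) U (𝓝 (∫ x, h x ∂(ν : Measure Θ))) := by
    intro h
    have := (ProbabilityMeasure.tendsto_iff_forall_integral_tendsto.1
      (show Tendsto P U (𝓝 ν) from hν)) (BoundedContinuousFunction.mkOfCompact h)
    refine this.congr fun n => ?_
    exact hint h h.continuous n
  have hνinv : MeasurePreserving r (ν : Measure Θ) (ν : Measure Θ) := by
    refine ⟨r.continuous.measurable, ?_⟩
    have : IsProbabilityMeasure ((ν : Measure Θ).map r) :=
      Measure.isProbabilityMeasure_map r.continuous.measurable.aemeasurable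
    refine ext_of_forall_integral_eq_of_IsFiniteMeasure fun h => ?_
    rw [integral_map r.continuous.measurable.aemeasurable
      h.continuous.aestronglyMeasurable]
    have h1 := hlim ((h : C(Θ, ℝ)).comp r)
    have h2 := hlim (h : C(Θ, ℝ))
    have h3 := (((tendsto_birkhoffAverage_apply_sub_birkhoffAverage' ℝ
      h.isBounded_range r θ).comp (tendsto_add_atTop_nat 1)).mono_left hU).add h2
    rw [zero_add] at h3
    refine tendsto_nhds_unique h1 (h3.congr fun n => ?_)
    simp only [Function.comp_apply, birkhoffAverage, birkhoffSum,
      ← Function.iterate_succ_apply' r, ← Function.iterate_succ_apply r,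
      ContinuousMap.comp_apply]
    exact sub_add_cancel _ _
  have := huniq ν ⟨inferInstance, hνinv⟩
  rw [← this]
  exact hlim g

/-! ### Degree of the lift -/

/-- A continuous real function all of whose values are integers is constant on a preconnected
space. -/
theorem eq_of_continuous_of_forall_mem_range_intCast {X : Type*} [TopologicalSpace X]
    [PreconnectedSpace X] {g : X → ℝ} (hg : Continuous g) (hint : ∀ x, ∃ n : ℤ, g x = n)
    (x y : X) : g x = g y := by
  choose n hn using hint
  have hn' : Continuous n := by
    have : Continuous fun x => ((n x : ℤ) : ℝ) := by simpa only [← hn] using hg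
    exact Int.isClosedEmbedding_coe_real.isEmbedding.continuous_iff.2 this
  rw [hn, hn, PreconnectedSpace.constant inferInstance hn' (x := x) (y := y)]

theorem exists_sub_eq_intCast_of_coe_eq {a b : ℝ}
    (h : (a : UnitAddCircle) = (b : UnitAddCircle)) : ∃ n : ℤ, a - b = n := by
  obtain ⟨n, hn⟩ := AddCircle.coe_eq_zero_iff (1 : ℝ) |>.1
    (show ((a - b : ℝ) : UnitAddCircle) = 0 by rw [AddCircle.coe_sub, h, sub_self])
  exact ⟨n, by simpa using hn.symm⟩

/-- A lift of a circle map homotopic to the identity in the fibres has degree one. -/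
theorem IsCircleLift.snd_add_one {Θ : Type*} [TopologicalSpace Θ] {r : C(Θ, Θ)}
    {f : C(Θ × UnitAddCircle, Θ × UnitAddCircle)} (hid : IsHomotopicToIdentity r f)
    {F : C(Θ × ℝ, Θ × ℝ)} (hF : IsCircleLift F f) (θ : Θ) (x : ℝ) :
    (F (θ, x + 1)).2 = (F (θ, x)).2 + 1 := by
  obtain ⟨K⟩ := hid
  let H : C(unitInterval × ℝ, UnitAddCircle) :=
    ⟨fun p => (K (p.1, (θ, (p.2 : UnitAddCircle)))).2, by fun_prop⟩
  let F₀ : C(ℝ, ℝ) := ⟨fun x => (F (θ, x)).2, by fun_prop⟩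
  have hFc : ∀ x : ℝ, ((F (θ, x)).2 : UnitAddCircle) = (f (θ, (x : UnitAddCircle))).2 :=
    fun x => congrArg Prod.snd (hF (θ, x))
  have H0 : ∀ x, H (0, x) = ((F₀ x : ℝ) : UnitAddCircle) := fun x => by
    simp only [H, F₀, ContinuousMap.coe_mk, K.apply_zero, hFc]
  have cov := AddCircle.isCoveringMap_coe (𝕜 := ℝ) 1
  let L := cov.liftHomotopy H F₀ H0
  have hL : ∀ p, ((L p : ℝ) : UnitAddCircle) = H p := fun p =>
    congrFun (cov.liftHomotopy_lifts H F₀ H0) p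
  have hL0 : ∀ x, L (0, x) = (F (θ, x)).2 := cov.liftHomotopy_zero H F₀ H0
  -- The degree is an integer depending continuously on the homotopy parameter; at time 1 the lift
  -- is a translation, so it is 1.
  have e1 := eq_of_continuous_of_forall_mem_range_intCast
    (g := fun p : unitInterval × ℝ => L (p.1, p.2 + 1) - L p) (by fun_prop)
    (fun p => exists_sub_eq_intCast_of_coe_eq (by
      rw [hL, hL]; simp only [H, ContinuousMap.coe_mk, AddCircle.coe_add]
      rw [AddCircle.coe_period, add_zero]))
    (0, x) (1, 0)
  have e2 := eq_of_continuous_of_forall_mem_range_intCast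
    (g := fun y : ℝ => L (1, y) - y) (by fun_prop)
    (fun y => exists_sub_eq_intCast_of_coe_eq (by
      rw [hL]; simp [H, K.apply_one]))
    1 0
  simp only [hL0, zero_add] at e1 e2
  linarith

/-! ### Growth rates from `N`-step increments -/

theorem abs_sub_le_mul_of_abs_succ_sub_le {x : ℕ → ℝ} {C : ℝ} (hx : ∀ k, |x (k + 1) - x k| ≤ C)
    (m i : ℕ) : |x (m + i) - x m| ≤ i * C := by
  induction i with
  | zero => simp
  | succ i ih =>
    have := abs_sub_le (x (m + (i + 1))) (x (m + i)) (x m)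
    have h2 := hx (m + i)
    rw [add_assoc] at h2
    push_cast
    linarith

/-- The sum of the `N`-step increments of a sequence is `N` times its total increment, up to an
error which does not depend on the length. -/
theorem abs_sum_sub_mul_le {x : ℕ → ℝ} {C : ℝ} (hx : ∀ k, |x (k + 1) - x k| ≤ C) (N n : ℕ) :
    |∑ k ∈ Finset.range n, (x (k + N) - x k) - N * (x n - x 0)| ≤ 2 * N ^ 2 * C := by
  have hC : 0 ≤ C := (abs_nonneg _).trans (hx 0)
  -- Exchange of order in the double sum of one-step increments.
  have key : ∑ k ∈ Finset.range n, (x (k + N) - x k)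
      = ∑ i ∈ Finset.range N, (x (n + i) - x i) := by
    induction N with
    | zero => simp
    | succ N ih =>
      rw [Finset.sum_range_succ, ← ih]
      have : ∑ k ∈ Finset.range n, (x (k + N + 1) - x (k + N)) = x (n + N) - x N := by
        have := Finset.sum_range_sub (fun k => x (k + N)) n
        simp only [zero_add] at this
        rw [← this]
        exact Finset.sum_congr rfl fun k _ => by rw [add_right_comm]
      rw [← this, ← Finset.sum_add_distrib]
      exact Finset.sum_congr rfl fun k _ => by rw [← add_assoc]; ring
  have h2 : ∑ k ∈ Finset.range n, (x (k + N) - x k) - N * (x n - x 0)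
      = ∑ i ∈ Finset.range N, ((x (n + i) - x n) - (x (0 + i) - x 0)) := by
    rw [key]
    have : (N : ℝ) * (x n - x 0) = ∑ i ∈ Finset.range N, (x n - x 0) := by
      rw [Finset.sum_const, Finset.card_range, nsmul_eq_mul]
    rw [this, ← Finset.sum_sub_distrib]
    exact Finset.sum_congr rfl fun k _ => by rw [zero_add]; ring
  rw [h2]
  refine (Finset.abs_sum_le_sum_abs _ _).trans ?_
  have : ∀ i ∈ Finset.range N, |(x (n + i) - x n) - (x (0 + i) - x 0)| ≤ 2 * N * C := by
    intro i hi
    have hi' : (i : ℝ) ≤ N := by exact_mod_cast (Finset.mem_range.1 hi).le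
    have h1 := abs_sub_le_mul_of_abs_succ_sub_le hx n i
    have h2 := abs_sub_le_mul_of_abs_succ_sub_le hx 0 i
    have h3 := mul_le_mul_of_nonneg_right hi' hC
    refine (abs_sub _ _).trans ?_
    linarith
  refine (Finset.sum_le_sum this).trans (le_of_eq ?_)
  simp; ring

/-- Comparison of the upper growth rate of a sequence with averages dominating its `N`-step
increments. -/
theorem limsup_le_of_sum_le {x : ℕ → ℝ} {C : ℝ} (hx : ∀ k, |x (k + 1) - x k| ≤ C) {N : ℕ}
    (hN : 0 < N) {a : ℕ → ℝ} {c : ℝ}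
    (hac : Tendsto (fun n : ℕ => (n : ℝ)⁻¹ * ∑ k ∈ Finset.range n, a k) atTop (𝓝 c))
    (ha : ∀ k, x (k + N) - x k ≤ a k) :
    N * limsup (fun n : ℕ => (1 / (n : ℝ)) * (x n - x 0)) atTop ≤ c := by
  have hN' : (0 : ℝ) < N := by exact_mod_cast hN
  rw [mul_comm, ← le_div_iff₀ hN']
  have hw : Tendsto (fun n : ℕ => ((n : ℝ)⁻¹ * ∑ k ∈ Finset.range n, a k) / N
      + (2 * N * C) * (n : ℝ)⁻¹) atTop (𝓝 (c / N + (2 * N * C) * 0)) :=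
    (hac.div_const _).add (tendsto_inv_atTop_nhds_zero_nat.const_mul _)
  rw [mul_zero, add_zero] at hw
  rw [← hw.limsup_eq]
  -- A real `limsup` is monotone only under boundedness.
  have hv : ∀ n : ℕ, |1 / (n : ℝ) * (x n - x 0)| ≤ C := fun n => by
    rcases Nat.eq_zero_or_pos n with rfl | hn
    · simpa using (abs_nonneg _).trans (hx 0)
    · have h1 := abs_sub_le_mul_of_abs_succ_sub_le hx 0 n
      rw [zero_add] at h1
      have hn' : (0 : ℝ) < n := by exact_mod_cast hn
      rw [abs_mul, abs_of_pos (by positivity), one_div, inv_mul_le_iff₀ hn']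
      exact h1
  refine limsup_le_limsup (Eventually.of_forall fun n => ?_) ?_ hw.isBoundedUnder_le
  · have h1 := (abs_le.1 (abs_sum_sub_mul_le hx N n)).1
    have h2 := Finset.sum_le_sum fun k (_ : k ∈ Finset.range n) => ha k
    have h3 : N * (x n - x 0) ≤ ∑ k ∈ Finset.range n, a k + 2 * N ^ 2 * C := by linarith
    have h4 : x n - x 0 ≤ (∑ k ∈ Finset.range n, a k) / N + 2 * N * C := by
      have : (∑ k ∈ Finset.range n, a k) / N + 2 * N * C
        = (∑ k ∈ Finset.range n, a k + 2 * N ^ 2 * C) / N := by field_simp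
      rw [this, le_div_iff₀ hN']; linarith
    have := mul_le_mul_of_nonneg_left h4 (show (0 : ℝ) ≤ (n : ℝ)⁻¹ by positivity)
    simp only [one_div]
    refine this.trans (le_of_eq ?_)
    ring
  · exact (isBoundedUnder_of ⟨-C, fun n => (abs_le.1 (hv n)).1⟩ :
      IsBoundedUnder (· ≥ ·) atTop _).isCoboundedUnder_le

/-- Mirror image of `limsup_le_of_sum_le`. Both average over all `k`, not multiples of `N`, since
`r^N` need not be uniquely ergodic. -/
theorem le_limsup_of_le_sum {x : ℕ → ℝ} {C : ℝ} (hx : ∀ k, |x (k + 1) - x k| ≤ C) {N : ℕ}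
    (hN : 0 < N) {a : ℕ → ℝ} {c : ℝ}
    (hac : Tendsto (fun n : ℕ => (n : ℝ)⁻¹ * ∑ k ∈ Finset.range n, a k) atTop (𝓝 c))
    (ha : ∀ k, a k ≤ x (k + N) - x k) :
    c ≤ N * limsup (fun n : ℕ => (1 / (n : ℝ)) * (x n - x 0)) atTop := by
  have hN' : (0 : ℝ) < N := by exact_mod_cast hN
  rw [mul_comm, ← div_le_iff₀ hN']
  have hw : Tendsto (fun n : ℕ => ((n : ℝ)⁻¹ * ∑ k ∈ Finset.range n, a k) / N
      - (2 * N * C) * (n : ℝ)⁻¹) atTop (𝓝 (c / N - (2 * N * C) * 0)) :=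
    (hac.div_const _).sub (tendsto_inv_atTop_nhds_zero_nat.const_mul _)
  rw [mul_zero, sub_zero] at hw
  rw [← hw.limsup_eq]
  have hv : ∀ n : ℕ, |1 / (n : ℝ) * (x n - x 0)| ≤ C := fun n => by
    rcases Nat.eq_zero_or_pos n with rfl | hn
    · simpa using (abs_nonneg _).trans (hx 0)
    · have h1 := abs_sub_le_mul_of_abs_succ_sub_le hx 0 n
      rw [zero_add] at h1
      have hn' : (0 : ℝ) < n := by exact_mod_cast hn
      rw [abs_mul, abs_of_pos (by positivity), one_div, inv_mul_le_iff₀ hn']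
      exact h1
  refine limsup_le_limsup (Eventually.of_forall fun n => ?_) hw.isCoboundedUnder_le
    (isBoundedUnder_of ⟨C, fun n => (abs_le.1 (hv n)).2⟩)
  · have h1 := (abs_le.1 (abs_sum_sub_mul_le hx N n)).2
    have h2 := Finset.sum_le_sum fun k (_ : k ∈ Finset.range n) => ha k
    have h4 : (∑ k ∈ Finset.range n, a k) / N - 2 * N * C ≤ x n - x 0 := by
      have : (∑ k ∈ Finset.range n, a k) / N - 2 * N * C
        = (∑ k ∈ Finset.range n, a k - 2 * N ^ 2 * C) / N := by field_simp
      rw [this, div_le_iff₀ hN']; linarith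
    have := mul_le_mul_of_nonneg_left h4 (show (0 : ℝ) ≤ (n : ℝ)⁻¹ by positivity)
    simp only [one_div]
    refine le_trans (le_of_eq ?_) this
    ring

/-! ### Displacements and stretching in the fibres -/

/-- The displacement of a self-map of `Θ × ℝ` in the fibre direction. -/
def fibreDisplacement {Θ : Type*} (G : Θ × ℝ → Θ × ℝ) (p : Θ × ℝ) : ℝ :=
  (G p).2 - p.2

/-- A fibred self-map of `Θ × ℝ` over `R` which commutes with the unit translation in each
fibre. -/
structure IsDegreeOneLift {Θ : Type*} [TopologicalSpace Θ] (R : Θ → Θ) (G : Θ × ℝ → Θ × ℝ) :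
    Prop where
  continuous : Continuous G
  fst_apply : ∀ p, (G p).1 = R p.1
  snd_add_one : ∀ θ x, (G (θ, x + 1)).2 = (G (θ, x)).2 + 1

namespace IsDegreeOneLift

section

variable {Θ : Type*} [TopologicalSpace Θ] {R : Θ → Θ} {G : Θ × ℝ → Θ × ℝ}

theorem iterate (h : IsDegreeOneLift R G) (n : ℕ) : IsDegreeOneLift R^[n] G^[n] := by
  have hfst : ∀ n p, (G^[n] p).1 = R^[n] p.1 := fun n p => by
    induction n with
    | zero => rfl
    | succ n ih => rw [Function.iterate_succ_apply', Function.iterate_succ_apply', h.fst_apply, ih]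
  refine ⟨h.continuous.iterate n, hfst n, fun θ x => ?_⟩
  induction n with
  | zero => rfl
  | succ n ih =>
    rw [Function.iterate_succ_apply', Function.iterate_succ_apply',
      ← h.snd_add_one (G^[n] (θ, x)).1]
    congr 2
    exact Prod.ext (by rw [hfst, hfst]) ih

theorem periodic (h : IsDegreeOneLift R G) (θ : Θ) :
    Function.Periodic (fun x => fibreDisplacement G (θ, x)) 1 := fun x => by
  simp only [fibreDisplacement, h.snd_add_one]; ring

theorem displacement_sub_int (h : IsDegreeOneLift R G) (θ : Θ) (x : ℝ) (m : ℤ) :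
    fibreDisplacement G (θ, x - m) = fibreDisplacement G (θ, x) := by
  simpa using (h.periodic θ).sub_int_mul_eq (x := x) m

theorem continuous_displacement (h : IsDegreeOneLift R G) :
    Continuous (fibreDisplacement G) := by
  have := h.continuous
  unfold fibreDisplacement
  fun_prop

/-- Largest displacement in a fibre. -/
noncomputable def maxDisplacement (G : Θ × ℝ → Θ × ℝ) (θ : Θ) : ℝ :=
  sSup ((fun x => fibreDisplacement G (θ, x)) '' Set.Icc 0 1)

/-- Smallest displacement in a fibre. -/
noncomputable def minDisplacement (G : Θ × ℝ → Θ × ℝ) (θ : Θ) : ℝ :=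
  sInf ((fun x => fibreDisplacement G (θ, x)) '' Set.Icc 0 1)

theorem continuous_maxDisplacement (h : IsDegreeOneLift R G) :
    Continuous (maxDisplacement G) :=
  isCompact_Icc.continuous_sSup (f := fun θ x => fibreDisplacement G (θ, x))
    h.continuous_displacement

theorem continuous_minDisplacement (h : IsDegreeOneLift R G) :
    Continuous (minDisplacement G) :=
  isCompact_Icc.continuous_sInf (f := fun θ x => fibreDisplacement G (θ, x))
    h.continuous_displacement

theorem isCompact_image_displacement (h : IsDegreeOneLift R G) (θ : Θ) :
    IsCompact ((fun x => fibreDisplacement G (θ, x)) '' Set.Icc (0 : ℝ) 1) :=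
  isCompact_Icc.image (h.continuous_displacement.comp (by fun_prop))

theorem displacement_mem_image (h : IsDegreeOneLift R G) (p : Θ × ℝ) :
    fibreDisplacement G p ∈ (fun x => fibreDisplacement G (p.1, x)) '' Set.Icc (0 : ℝ) 1 := by
  refine ⟨Int.fract p.2, ⟨Int.fract_nonneg _, (Int.fract_lt_one _).le⟩, ?_⟩
  exact h.displacement_sub_int _ _ _

theorem displacement_le_max (h : IsDegreeOneLift R G) (p : Θ × ℝ) :
    fibreDisplacement G p ≤ maxDisplacement G p.1 :=
  le_csSup (h.isCompact_image_displacement p.1).bddAbove (h.displacement_mem_image p)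

theorem min_le_displacement (h : IsDegreeOneLift R G) (p : Θ × ℝ) :
    minDisplacement G p.1 ≤ fibreDisplacement G p :=
  csInf_le (h.isCompact_image_displacement p.1).bddBelow (h.displacement_mem_image p)

theorem exists_displacement_eq {θ : Θ} {v : ℝ} (h : IsDegreeOneLift R G)
    (hv : v ∈ (fun x => fibreDisplacement G (θ, x)) '' Set.Icc (0 : ℝ) 1) (c : ℝ) :
    ∃ x ∈ Set.Icc c (c + 1), fibreDisplacement G (θ, x) = v := by
  obtain ⟨x, -, hx⟩ := hv
  refine ⟨x - ⌊x - c⌋, ⟨?_, ?_⟩, ?_⟩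
  · linarith [Int.floor_le (x - c)]
  · linarith [Int.lt_floor_add_one (x - c)]
  · rw [h.displacement_sub_int, ← hx]

/-- A fibre with large displacement difference is stretched over several fundamental domains. -/
theorem exists_Icc_subset_image_of_le (h : IsDegreeOneLift R G) {θ : Θ} {K : ℝ}
    (hθ : K + 1 ≤ maxDisplacement G θ - minDisplacement G θ) (c : ℝ) :
    ∃ d, Set.Icc d (d + K) ⊆ (fun x => (G (θ, x)).2) '' Set.Icc c (c + 1) := by
  have hne : ((fun x => fibreDisplacement G (θ, x)) '' Set.Icc (0 : ℝ) 1).Nonempty :=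
    (Set.nonempty_Icc.2 zero_le_one).image _
  obtain ⟨x, hx, hxv⟩ := h.exists_displacement_eq
    ((h.isCompact_image_displacement θ).sSup_mem hne) c
  obtain ⟨y, hy, hyv⟩ := h.exists_displacement_eq
    ((h.isCompact_image_displacement θ).sInf_mem hne) c
  have hcont : Continuous fun x : ℝ => (G (θ, x)).2 := by
    have := h.continuous
    fun_prop
  have hsub : Set.uIcc y x ⊆ Set.Icc c (c + 1) := Set.Icc_subset_Icc
    (le_inf hy.1 hx.1) (sup_le hy.2 hx.2)
  refine ⟨(G (θ, y)).2, ?_⟩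
  refine Set.Subset.trans ?_ (Set.image_mono hsub)
  refine Set.Subset.trans ?_ (intermediate_value_uIcc hcont.continuousOn)
  -- The images differ by max minus min plus `x - y ≥ -1`, hence the `K + 1`.
  refine Set.Subset.trans (Set.Icc_subset_Icc_right ?_) Set.Icc_subset_uIcc
  simp only [fibreDisplacement] at hxv hyv
  change _ = maxDisplacement G θ at hxv
  change _ = minDisplacement G θ at hyv
  linarith [hx.1, hy.2]

/-- Degree one makes every fundamental domain cover another, so fibres without stretching keep all
separated points. -/
theorem Icc_subset_image (h : IsDegreeOneLift R G) (θ : Θ) (c : ℝ) :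
    Set.Icc (G (θ, c)).2 ((G (θ, c)).2 + 1) ⊆ (fun x => (G (θ, x)).2) '' Set.Icc c (c + 1) := by
  have hcont : Continuous fun x : ℝ => (G (θ, x)).2 := by
    have := h.continuous
    fun_prop
  have := intermediate_value_Icc (by linarith : c ≤ c + 1) hcont.continuousOn
  rwa [h.snd_add_one] at this

end

variable {Θ : Type*} [MetricSpace Θ] {R : Θ → Θ} {G : Θ × ℝ → Θ × ℝ}

theorem exists_forall_abs_displacement_le [CompactSpace Θ] (h : IsDegreeOneLift R G) :
    ∃ C, ∀ p, |fibreDisplacement G p| ≤ C := by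
  obtain ⟨C, hC⟩ := ((isCompact_univ (X := Θ)).prod (isCompact_Icc (a := (0 : ℝ)) (b := 1))
    |>.exists_bound_of_continuousOn h.continuous_displacement.continuousOn)
  refine ⟨C, fun p => ?_⟩
  obtain ⟨x, hx, hxp⟩ := h.displacement_mem_image p
  rw [← hxp]
  exact hC (p.1, x) ⟨trivial, hx⟩

/-- Points at distance at most one in a fibre whose images are at distance at least two in `ℝ` are
uniformly apart on the circle. -/
theorem exists_forall_le_norm_coe_sub [CompactSpace Θ] (h : IsDegreeOneLift R G) :
    ∃ δ > 0, ∀ (θ : Θ) (s t : ℝ), |s - t| ≤ 1 → 2 ≤ |(G (θ, s)).2 - (G (θ, t)).2| →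
      δ ≤ ‖((s - t : ℝ) : UnitAddCircle)‖ := by
  have huc := ((isCompact_univ (X := Θ)).prod
    (isCompact_Icc (a := (-1 : ℝ)) (b := 2))).uniformContinuousOn_of_continuous
    h.continuous_displacement.continuousOn
  -- If `s - t` is near an integer `m`, then `|m| ≤ 1` and the images differ by less than 1/2
  -- (displacements) + 1/2 + 1 = 2.
  obtain ⟨δ, hδ, hd⟩ := Metric.uniformContinuousOn_iff.1 huc (1 / 2) (by norm_num)
  refine ⟨min δ (1 / 2), by positivity, fun θ s t hst hG => ?_⟩
  by_contra! hlt
  rw [UnitAddCircle.norm_eq] at hlt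
  set m := round (s - t)
  have hlt1 : |s - t - m| < δ := hlt.trans_le (min_le_left _ _)
  have hlt2 : |s - t - m| < 1 / 2 := hlt.trans_le (min_le_right _ _)
  have hs0 := Int.fract_nonneg s
  have hs1 := Int.fract_lt_one s
  have hs : s - ⌊s⌋ = Int.fract s := rfl
  have hm : |(m : ℝ)| ≤ 1 := by
    have : |(m : ℝ)| < 2 := by
      rw [abs_lt] at hlt2 ⊢; rw [abs_le] at hst
      constructor <;> linarith
    have : |m| < 2 := by exact_mod_cast this
    exact_mod_cast (by omega : |m| ≤ 1)
  have h2 := hd (θ, s - ⌊s⌋) ⟨trivial, by constructor <;> linarith⟩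
    (θ, t - (⌊s⌋ - m : ℤ)) ⟨trivial, by
      rw [abs_lt] at hlt2; push_cast; constructor <;> linarith⟩ (by
      rw [Prod.dist_eq, dist_self, max_eq_right dist_nonneg, Real.dist_eq]
      push_cast
      rwa [show s - ⌊s⌋ - (t - (⌊s⌋ - m)) = s - t - (m : ℝ) by ring])
  rw [Real.dist_eq, h.displacement_sub_int, h.displacement_sub_int] at h2
  simp only [fibreDisplacement] at h2
  rw [abs_lt] at hlt2 h2
  rw [abs_le] at hm
  rcases le_abs.1 hG with h3 | h3 <;> linarith

/-! ### Horseshoe and entropy -/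

/-- Fibred horseshoe: along an orbit of the base which visits `P` at `k` times, a fundamental
domain of the fibre contains `2 ^ k` separated points, if the fibres over `P` are stretched over at
least four fundamental domains. -/
theorem exists_finset_separated (h : IsDegreeOneLift R G) {δ : ℝ}
    (hδ : ∀ (θ : Θ) (s t : ℝ), |s - t| ≤ 1 → 2 ≤ |(G (θ, s)).2 - (G (θ, t)).2| →
      δ ≤ ‖((s - t : ℝ) : UnitAddCircle)‖)
    {P : Θ → Prop} [DecidablePred P]
    (hP : ∀ θ, P θ → ∀ c, ∃ d, Set.Icc d (d + 4) ⊆ (fun x => (G (θ, x)).2) '' Set.Icc c (c + 1))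
    (n : ℕ) (θ : Θ) (c : ℝ) :
    ∃ S : Finset ℝ, (S : Set ℝ) ⊆ Set.Icc c (c + 1) ∧
      2 ^ ((Finset.range n).filter fun j => P (R^[j] θ)).card ≤ S.card ∧
      ∀ s ∈ S, ∀ t ∈ S, s ≠ t →
        ∃ j < n, δ ≤ dist (circleProj (G^[j] (θ, s))) (circleProj (G^[j] (θ, t))) := by
  induction n generalizing θ c with
  | zero => exact ⟨{c}, by simp, by simp, by simp⟩
  | succ n ih =>
    have hG : ∀ x, G (θ, x) = (R θ, (G (θ, x)).2) := fun x => Prod.ext (h.fst_apply _) rfl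
    -- Separated points over `R θ` pull back to `θ`, with separation one step later.
    have pull : ∀ d, Set.Icc d (d + 1) ⊆ (fun x => (G (θ, x)).2) '' Set.Icc c (c + 1) →
        ∃ S : Finset ℝ, (S : Set ℝ) ⊆ Set.Icc c (c + 1) ∧
          2 ^ ((Finset.range n).filter fun j => P (R^[j] (R θ))).card ≤ S.card ∧
          (∀ s ∈ S, (G (θ, s)).2 ∈ Set.Icc d (d + 1)) ∧
          ∀ s ∈ S, ∀ t ∈ S, s ≠ t →
            ∃ j < n + 1, δ ≤ dist (circleProj (G^[j] (θ, s))) (circleProj (G^[j] (θ, t))) := by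
      intro d hd
      obtain ⟨S, hS, hcard, hsep⟩ := ih (R θ) d
      have hex : ∀ y ∈ S, ∃ x, x ∈ Set.Icc c (c + 1) ∧ (G (θ, x)).2 = y := fun y hy => hd (hS hy)
      choose! u hu huG using hex
      have hinj : Set.InjOn u S := fun a ha b hb hab => by
        rw [← huG a ha, ← huG b hb, hab]
      refine ⟨S.image u, ?_, ?_, ?_, ?_⟩
      · intro x hx
        obtain ⟨y, hy, rfl⟩ := Finset.mem_image.1 (Finset.mem_coe.1 hx)
        exact hu y hy
      · rwa [Finset.card_image_of_injOn hinj]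
      · intro x hx
        obtain ⟨y, hy, rfl⟩ := Finset.mem_image.1 hx
        rw [huG y hy]
        exact hS hy
      · intro x hx x' hx' hne
        obtain ⟨y, hy, rfl⟩ := Finset.mem_image.1 hx
        obtain ⟨y', hy', rfl⟩ := Finset.mem_image.1 hx'
        obtain ⟨j, hj, hjd⟩ := hsep y hy y' hy' (fun e => hne (by rw [e]))
        refine ⟨j + 1, by omega, ?_⟩
        rwa [Function.iterate_succ_apply, Function.iterate_succ_apply, hG, hG (u y'), huG y hy,
          huG y' hy']
    have hcount : ((Finset.range (n + 1)).filter fun j => P (R^[j] θ)).card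
        = (if P θ then 1 else 0) + ((Finset.range n).filter fun j => P (R^[j] (R θ))).card := by
      simp only [Finset.card_filter, Finset.sum_range_succ', Function.iterate_succ_apply,
        Function.iterate_zero_apply]
      rw [add_comm]
      rfl
    rw [hcount]
    by_cases hθ : P θ
    -- The two end unit intervals of `[d, d + 4]` are 2 apart, as `hδ` requires: their preimages are
    -- separated at time 0.
    · obtain ⟨d, hd⟩ := hP θ hθ c
      obtain ⟨S, hS, hScard, hSG, hSsep⟩ := pull d
        ((Set.Icc_subset_Icc_right (by linarith)).trans hd)
      obtain ⟨T, hT, hTcard, hTG, hTsep⟩ := pull (d + 3)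
        ((Set.Icc_subset_Icc (by linarith) (by linarith)).trans hd)
      have hcross : ∀ s ∈ S, ∀ t ∈ T, δ ≤ dist (circleProj (θ, s)) (circleProj (θ, t)) := by
        intro s hs t ht
        have h1 := hSG s hs
        have h2 := hTG t ht
        have h3 := hS hs
        have h4 := hT ht
        simp only [circleProj]
        rw [Prod.dist_eq, dist_self, max_eq_right dist_nonneg, dist_eq_norm,
          ← AddCircle.coe_sub]
        refine hδ θ s t (abs_le.2 ⟨by linarith [h3.1, h4.2], by linarith [h3.2, h4.1]⟩) ?_
        rw [abs_sub_comm]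
        exact le_abs.2 (Or.inl (by linarith [h1.2, h2.1]))
      have hdisj : Disjoint S T := Finset.disjoint_left.2 fun s hs ht => by
        linarith [(hSG s hs).2, (hTG s ht).1]
      refine ⟨S ∪ T, ?_, ?_, ?_⟩
      · rw [Finset.coe_union]; exact Set.union_subset hS hT
      · rw [Finset.card_union_of_disjoint hdisj, if_pos hθ, pow_add, pow_one, two_mul]
        exact add_le_add hScard hTcard
      · intro s hs t ht hne
        rcases Finset.mem_union.1 hs with hs | hs <;> rcases Finset.mem_union.1 ht with ht | ht
        · exact hSsep s hs t ht hne
        · exact ⟨0, by omega, hcross s hs t ht⟩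
        · exact ⟨0, by omega, by rw [dist_comm]; exact hcross t ht s hs⟩
        · exact hTsep s hs t ht hne
    · obtain ⟨S, hS, hScard, -, hSsep⟩ := pull _ (h.Icc_subset_image θ c)
      exact ⟨S, hS, by simpa [hθ] using hScard, hSsep⟩

end IsDegreeOneLift

theorem IsCircleLift.circleProj_iterate {Θ : Type*} [TopologicalSpace Θ] {F : C(Θ × ℝ, Θ × ℝ)}
    {f : C(Θ × UnitAddCircle, Θ × UnitAddCircle)} (hF : IsCircleLift F f) (n : ℕ) (p : Θ × ℝ) :
    circleProj (F^[n] p) = f^[n] (circleProj p) :=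
  (show Function.Semiconj circleProj F f from hF).iterate_right n p

/-- If the Birkhoff averages of `D` at some point tend to a limit larger than `c`, then along some
orbit of the iterate `r^[N]` the average of `D` over `n` points is at least `c`. -/
theorem eventually_exists_le_sum_iterate {Θ : Type*} {r : Θ → Θ} {D : Θ → ℝ} {θ : Θ} {l c : ℝ}
    (hl : Tendsto (fun n => birkhoffAverage ℝ r D n θ) atTop (𝓝 l)) (hc : c < l) {N : ℕ}
    (hN : 0 < N) :
    ∀ᶠ n : ℕ in atTop, ∃ θ' : Θ, c * n ≤ ∑ k ∈ Finset.range n, D ((r^[N])^[k] θ') := by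
  have hmul : Tendsto (fun n : ℕ => N * n) atTop atTop :=
    tendsto_id.const_mul_atTop' hN
  filter_upwards [(hl.comp hmul).eventually (lt_mem_nhds hc), eventually_gt_atTop 0] with n hn hn0
  by_contra! hcon
  -- An `r`-orbit splits by residues mod `N` into `r^N`-orbits, one of which has at least the
  -- overall average.
  have hsplit : ∀ n, ∑ i ∈ Finset.range (N * n), D (r^[i] θ)
      = ∑ j ∈ Finset.range N, ∑ k ∈ Finset.range n, D ((r^[N])^[k] (r^[j] θ)) := by
    intro n
    induction n with
    | zero => simp
    | succ n ih =>
      rw [Nat.mul_succ, Finset.sum_range_add, ih, ← Finset.sum_add_distrib]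
      refine Finset.sum_congr rfl fun j _ => ?_
      rw [Finset.sum_range_succ, ← Function.iterate_mul, ← Function.iterate_add_apply]
  have hN' : (0 : ℝ) < N := by exact_mod_cast hN
  have hn' : (0 : ℝ) < n := by exact_mod_cast hn0
  have hlt : ∑ i ∈ Finset.range (N * n), D (r^[i] θ) < ∑ j ∈ Finset.range N, c * n := by
    rw [hsplit]
    exact Finset.sum_lt_sum_of_nonempty (Finset.nonempty_range_iff.2 hN.ne')
      fun j _ => hcon _
  simp only [Function.comp_apply, birkhoffAverage, birkhoffSum, smul_eq_mul] at hn
  rw [Finset.sum_const, Finset.card_range, nsmul_eq_mul] at hlt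
  rw [lt_inv_mul_iff₀ (by push_cast; positivity)] at hn
  push_cast at hn
  linarith

/-- Positivity of entropy from exponentially many points separated along an iterate. -/
theorem topEntropy_pos_of_separated {X : Type*} [PseudoMetricSpace X] {f : X → X} {N : ℕ}
    (hN : 0 < N) {δ M : ℝ} (hδ : 0 < δ) (hM : 0 < M)
    (h : ∀ᶠ n : ℕ in atTop, ∃ (S : Finset X) (k : ℕ), n ≤ M * k ∧ 2 ^ k ≤ S.card ∧
      ∀ x ∈ S, ∀ y ∈ S, x ≠ y → ∃ j < n, δ ≤ dist ((f^[N])^[j] x) ((f^[N])^[j] y)) :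
    0 < topEntropy f := by
  have hN' : (0 : ℝ) < N := by exact_mod_cast hN
  let U : Set (X × X) := {p | dist p.1 p.2 < δ / 2}
  have hU : U ∈ uniformity X := Metric.dist_mem_uniformity (by positivity)
  refine lt_of_lt_of_le ?_ (Dynamics.netEntropyEntourage_le_coverEntropy f Set.univ hU)
  let a : ℝ := Real.log 2 / (N * M)
  have ha : 0 < a := by have := Real.log_pos one_lt_two; positivity
  refine lt_of_lt_of_le (EReal.coe_pos.2 ha) ?_
  refine Frequently.le_expGrowthSup ?_
  have hmul : Tendsto (fun n : ℕ => N * n) atTop atTop :=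
    tendsto_id.const_mul_atTop' hN
  refine hmul.frequently (Eventually.frequently ?_)
  filter_upwards [h] with n ⟨S, k, hk, hS, hsep⟩
  have hnet : Dynamics.IsDynNetIn f Set.univ U (N * n) S := by
    refine ⟨Set.subset_univ _, fun x hx y hy hne => Set.disjoint_left.2 fun z hzx hzy => ?_⟩
    obtain ⟨j, hj, hd⟩ := hsep x hx y hy hne
    rw [← Function.iterate_mul] at hd
    have hjN : N * j < N * n := Nat.mul_lt_mul_of_pos_left hj hN
    have h1 : dist (f^[N * j] x) (f^[N * j] z) < δ / 2 :=
      Dynamics.mem_ball_dynEntourage.1 hzx (N * j) hjN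
    have h2 : dist (f^[N * j] y) (f^[N * j] z) < δ / 2 :=
      Dynamics.mem_ball_dynEntourage.1 hzy (N * j) hjN
    linarith [dist_triangle_right (f^[N * j] x) (f^[N * j] y) (f^[N * j] z)]
  have hcard := hnet.card_le_netMaxcard
  have hexp : Real.exp (a * (N * n : ℕ)) ≤ S.card := by
    have h2 : a * (N * n : ℕ) ≤ Real.log 2 * k := by
      have : a * (N * n : ℕ) = Real.log 2 * (n / M) := by
        simp only [a]; push_cast; field_simp
      rw [this]
      refine mul_le_mul_of_nonneg_left ?_ (Real.log_pos one_lt_two).le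
      rw [div_le_iff₀ hM]; linarith
    refine (Real.exp_le_exp.2 h2).trans ?_
    rw [Real.exp_mul, Real.exp_log two_pos, Real.rpow_natCast]
    exact_mod_cast hS
  have e : EReal.exp ((a : EReal) * ((N * n : ℕ) : EReal))
      = ENNReal.ofReal (Real.exp (a * (N * n : ℕ))) := by
    rw [← EReal.exp_coe]; push_cast; rfl
  rw [e]
  refine (ENNReal.ofReal_le_ofReal hexp).trans ?_
  rw [ENNReal.ofReal_natCast]
  exact_mod_cast ENat.toENNReal_mono hcard

theorem exists_lt_of_interior_nonempty {s : Set ℝ} (h : (interior s).Nonempty) :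
    ∃ a ∈ s, ∃ b ∈ s, a < b := by
  obtain ⟨x, hx⟩ := h
  obtain ⟨ε, hε, hball⟩ := Metric.isOpen_iff.1 isOpen_interior x hx
  refine ⟨x, interior_subset hx, x + ε / 2, interior_subset (hball ?_), by linarith⟩
  rw [Metric.mem_ball, Real.dist_eq, add_sub_cancel_left, abs_of_pos (by linarith)]
  linarith

theorem theoremt {Θ : Type*} [MetricSpace Θ] [CompactSpace Θ] [MeasurableSpace Θ] [BorelSpace Θ]
    (r : C(Θ, Θ)) (hr : IsUniquelyErgodic r)
    (f : C(Θ × UnitAddCircle, Θ × UnitAddCircle))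
    (hf : IsForcedCircleMap r f) (hid : IsHomotopicToIdentity r f)
    (F : C(Θ × ℝ, Θ × ℝ)) (hF : IsCircleLift F f)
    (hρ : (interior (fibredRotationInterval F)).Nonempty) :
    0 < topEntropy f := by
  have hL : IsDegreeOneLift r F := ⟨F.continuous, fun p => by
    have := congrArg Prod.fst (hF p)
    exact this.trans (hf p.1 (p.2 : UnitAddCircle)), hF.snd_add_one hid⟩
  obtain ⟨a, ⟨q, hq⟩, b, ⟨p, hp⟩, hab⟩ := exists_lt_of_interior_nonempty hρ
  obtain ⟨N, hN⟩ := exists_nat_gt (6 / (b - a))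
  have hba : 0 < b - a := by linarith
  have hN' : (0 : ℝ) < N := lt_trans (by positivity) hN
  have hN0 : 0 < N := by exact_mod_cast hN'
  rw [div_lt_iff₀ hba] at hN
  have hG := hL.iterate N
  obtain ⟨C, hC⟩ := hL.exists_forall_abs_displacement_le
  have hinc : ∀ p : Θ × ℝ, ∀ k, |(F^[k + 1] p).2 - (F^[k] p).2| ≤ C := fun p k => by
    rw [Function.iterate_succ_apply']
    exact hC _
  have hdisp : ∀ (p : Θ × ℝ) (k : ℕ),
      (F^[k + N] p).2 - (F^[k] p).2 = fibreDisplacement F^[N] (F^[k] p) := fun p k => by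
    rw [add_comm, Function.iterate_add_apply]; rfl
  have hfst : ∀ (p : Θ × ℝ) (k : ℕ), (F^[k] p).1 = r^[k] p.1 := fun p k =>
    (hL.iterate k).fst_apply p
  obtain ⟨cmax, hmax⟩ := hr.exists_tendsto_birkhoffAverage ⟨_, hG.continuous_maxDisplacement⟩
  obtain ⟨cmin, hmin⟩ := hr.exists_tendsto_birkhoffAverage ⟨_, hG.continuous_minDisplacement⟩
  have hb : N * b ≤ cmax := by
    rw [← hp]
    refine limsup_le_of_sum_le (hinc p) hN0 (hmax p.1) fun k => ?_
    change _ ≤ IsDegreeOneLift.maxDisplacement F^[N] (r^[k] p.1)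
    rw [hdisp, ← hfst]
    exact hG.displacement_le_max _
  have ha : cmin ≤ N * a := by
    rw [← hq]
    refine le_limsup_of_le_sum (hinc q) hN0 (hmin q.1) fun k => ?_
    change IsDegreeOneLift.minDisplacement F^[N] (r^[k] q.1) ≤ _
    rw [hdisp, ← hfst]
    exact hG.min_le_displacement _
  let D : Θ → ℝ := fun θ =>
    IsDegreeOneLift.maxDisplacement F^[N] θ - IsDegreeOneLift.minDisplacement F^[N] θ
  have hD : Tendsto (fun n => birkhoffAverage ℝ r D n p.1) atTop (𝓝 (cmax - cmin)) := by
    refine ((hmax p.1).sub (hmin p.1)).congr fun n => ?_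
    rw [← Pi.sub_apply, ← Pi.sub_apply, ← birkhoffAverage_sub]
    rfl
  obtain ⟨M, hMD⟩ : ∃ M, ∀ θ, D θ ≤ M := by
    obtain ⟨M, hM⟩ := isCompact_univ.exists_bound_of_continuousOn
      (hG.continuous_maxDisplacement.sub hG.continuous_minDisplacement).continuousOn
    exact ⟨M, fun θ => (le_abs_self _).trans (hM θ trivial)⟩
  obtain ⟨δ, hδ, hsep⟩ := hG.exists_forall_le_norm_coe_sub
  refine topEntropy_pos_of_separated hN0 hδ (M := max M 1) (by positivity) ?_
  filter_upwards [eventually_exists_le_sum_iterate hD (c := 6) (by linarith) hN0] with n ⟨θ, hθ⟩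
  classical
  obtain ⟨S, -, hcard, hS⟩ := hG.exists_finset_separated hsep (P := fun θ => 4 + 1 ≤ D θ)
    (fun θ hθ c => hG.exists_Icc_subset_image_of_le hθ c) n θ 0
  have hproj : ∀ (j : ℕ) (s : ℝ), circleProj ((F^[N])^[j] (θ, s))
      = (f^[N])^[j] (circleProj (θ, s)) := fun j s => by
    rw [← Function.iterate_mul, ← Function.iterate_mul, hF.circleProj_iterate]
  simp only [hproj] at hS
  have hinj : Set.InjOn (fun s : ℝ => circleProj (θ, s)) S := fun s hs t ht hst => by
    by_contra hne
    obtain ⟨j, -, hj⟩ := hS s hs t ht hne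
    simp only at hst
    rw [hst, dist_self] at hj
    linarith
  refine ⟨S.image fun s => circleProj (θ, s),
    ((Finset.range n).filter fun j => 4 + 1 ≤ D ((r^[N])^[j] θ)).card, ?_, ?_, ?_⟩
  · have hle : ∀ k ∈ Finset.range n, D ((r^[N])^[k] θ)
        ≤ 5 + max M 1 * (if 4 + 1 ≤ D ((r^[N])^[k] θ) then 1 else 0) := fun k _ => by
      split_ifs with h5
      · linarith [hMD ((r^[N])^[k] θ), le_max_left M 1]
      · linarith
    have := hθ.trans (Finset.sum_le_sum hle)
    rw [Finset.sum_add_distrib, ← Finset.mul_sum, Finset.sum_boole, Finset.sum_const,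
      Finset.card_range, nsmul_eq_mul] at this
    linarith
  · rwa [Finset.card_image_of_injOn hinj]
  · intro x hx y hy hne
    obtain ⟨s, hs, rfl⟩ := Finset.mem_image.1 hx
    obtain ⟨t, ht, rfl⟩ := Finset.mem_image.1 hy
    exact hS s hs t ht fun e => hne (by rw [e])
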